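/- Let $0\le t<1$ and $T>0$, put $Q(z)=\tfrac t2 z^2$ and $$V(z)=|z|^2-Q(z)-\overline{Q(z)}=|z|^2-t\,\mathrm{Re}(z^2),\qquad K=\Big\{z\in\mathbb C:\ \tfrac{1-t}{1+t}(\mathrm{Re}\,z)^2+\tfrac{1+t}{1-t}(\mathrm{Im}\,z)^2\le T\Big\},$$ and let $dA$ denote the area measure on $\mathbb C$. For $N>0$ let $p_0,p_1,p_2,\dots$ (depending on $N$) be orthonormal polynomials for the weight $e^{-NV}$, that is, $p_j$ is a polynomial of degree exactly $j$ and $$\int_{\mathbb C}p_j(w)\,\overline{p_k(w)}\,e^{-NV(w)}\,dA(w)=\delta_{jk}\qquad(j,k\ge 0);$$ such polynomials exist for every $N>0$. Then for every $z\in\mathrm{Int}\,K$ there are constants $\varepsilon>0$, $C>0$ and $N_0>0$, depending only on $t$, $T$ and $z$, such that for every real $N>N_0$ for which $n=NT$ is an integer, and for every such choice of orthonormal polynomials, the integral below converges absolutely and $$\left|\int_{\mathbb C}\frac{|p_n(w)|^2\,e^{-NV(w)}}{z-w}\,dA(w)\right|\le C\,e^{-\varepsilon N}.$$ -/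

import Mathlib

open MeasureTheory Polynomial
open scoped ComplexConjugate

noncomputable section

/-- The potential `V(z) = |z|² - Q(z) - conj (Q(z))`, which is real valued. -/
def potential (Q : ℂ → ℂ) (z : ℂ) : ℝ := ‖z‖ ^ 2 - 2 * (Q z).re

/-- The weight `exp (-N V(z))`. -/
def weight (V : ℂ → ℝ) (N : ℝ) (z : ℂ) : ℝ := Real.exp (-N * V z)

/-- `p 0, p 1, …` are orthonormal polynomials for the weight `exp (-N V)` with respect to the
area measure of the plane: `p j` has degree exactly `j`, and
`∫ p_j(z) conj (p_k(z)) exp (-N V(z)) dA(z) = δ_{jk}`.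
(Each diagonal integral is nonzero, so each `|p_j|² exp (-N V)` is integrable, and hence so are
the products with `j ≠ k`.) -/
structure IsOrthonormalPolynomials (V : ℂ → ℝ) (N : ℝ) (p : ℕ → ℂ[X]) : Prop where
  degree_eq : ∀ j, (p j).degree = j
  integral_eq : ∀ j k,
    ∫ z : ℂ, (p j).eval z * conj ((p k).eval z) * (weight V N z : ℂ) = if j = k then 1 else 0

/-- The integrand `|q(w)|² exp (-N V(w)) / (z - w)` of the Cauchy transform at `z`. -/
def cauchyIntegrand (V : ℂ → ℝ) (N : ℝ) (q : ℂ[X]) (z w : ℂ) : ℂ :=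
  ((‖q.eval w‖ ^ 2 * weight V N w : ℝ) : ℂ) / (z - w)

/-- The droplet, an elliptical region. -/
def droplet (t T : ℝ) : Set ℂ :=
  {z | (1 - t) / (1 + t) * z.re ^ 2 + (1 + t) / (1 - t) * z.im ^ 2 ≤ T}

end

/-! For `r` of degree at most `n`, the polynomial `p_n(w) r(z) - p_n(z) r(w)` is `w - z` times a
polynomial of degree below `n`, which is orthogonal to `p_n`. Hence the Cauchy transform `I` of
`|p_n|² e^{-NV}` at `z` satisfies `I r(z) = p_n(z) ∫ r conj(p_n) e^{-NV} / (z - w)`. For `r = p_k`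
the last integral is `O(1 + N)`, so `|I| |p_k(z)| ≤ |p_n(z)| O(1 + N)` for all `k ≤ n`
(`norm_integral_cauchyIntegrand_mul_le`).

It remains to see that `|p_n(z)|` is exponentially small relative to some earlier values. Up to
phases the `p_k` are normalized Hermite polynomials (`exists_eq_C_mul`), whose three-term recurrence
is nearly constant for `k` close to `n`. Its limiting characteristic roots satisfy `l₁ + l₂ = z /
B`, `l₁ l₂ = t` with `B = √(T / (1 - t²))`, and both lie in the open unit disk when `z` is inside
the ellipse (`exists_roots_norm_lt_one`). So the values contract over the last `δ n` degrees
(`exists_hermiteValue_decay`). -/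

/-! ### The Gaussian weight and integrability -/

/-- The quadratic potential `|z|² - t Re (z²)` in real coordinates. -/
lemma potential_quadratic (t : ℝ) (w : ℂ) :
    potential (fun z => (t : ℂ) * z ^ 2 / 2) w = (1 - t) * w.re ^ 2 + (1 + t) * w.im ^ 2 := by
  have h : ((t : ℂ) * w ^ 2 / 2).re = t * (w.re ^ 2 - w.im ^ 2) / 2 := by
    have : (t : ℂ) * w ^ 2 / 2 = ((t / 2 : ℝ) : ℂ) * (w * w) := by push_cast; ring
    rw [this, Complex.re_ofReal_mul, Complex.mul_re]; ring
  rw [potential, h, Complex.sq_norm, Complex.normSq_apply]; ring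

/-- The Gaussian weight `exp (-N (|w|² - t Re (w²)))`. -/
noncomputable def gaussWeight (t N : ℝ) (w : ℂ) : ℝ :=
  weight (potential (fun z => (t : ℂ) * z ^ 2 / 2)) N w

lemma gaussWeight_eq (t N : ℝ) (w : ℂ) :
    gaussWeight t N w = Real.exp (-N * ((1 - t) * w.re ^ 2 + (1 + t) * w.im ^ 2)) := by
  rw [gaussWeight, weight, potential_quadratic]

lemma gaussWeight_pos (t N : ℝ) (w : ℂ) : 0 < gaussWeight t N w := Real.exp_pos _

lemma continuous_gaussWeight (t N : ℝ) : Continuous (gaussWeight t N) := by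
  rw [funext (gaussWeight_eq t N)]
  fun_prop

lemma gaussWeight_le {t N : ℝ} (ht : 0 ≤ t) (hN : 0 < N) (w : ℂ) :
    gaussWeight t N w ≤ Real.exp (-(N * (1 - t)) * ‖w‖ ^ 2) := by
  rw [gaussWeight_eq, Complex.sq_norm, Complex.normSq_apply]
  apply Real.exp_le_exp.2
  nlinarith [mul_nonneg (mul_nonneg hN.le ht) (sq_nonneg w.im)]

lemma integrable_norm_pow_mul_exp_neg_mul_sq {b : ℝ} (hb : 0 < b) (k : ℕ) :
    Integrable (fun w : ℂ => ‖w‖ ^ k * Real.exp (-b * ‖w‖ ^ 2)) := by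
  refine (integrable_fun_norm_addHaar (E := ℂ) volume
    (f := fun y => y ^ k * Real.exp (-b * y ^ 2))).2 ?_
  have h := integrableOn_rpow_mul_exp_neg_mul_sq hb (s := ((k + 1 : ℕ) : ℝ))
    (by have : (0 : ℝ) ≤ ((k + 1 : ℕ) : ℝ) := by positivity
        linarith)
  refine h.congr_fun (fun y _ => ?_) measurableSet_Ioi
  simp only [Complex.finrank_real_complex, Real.rpow_natCast, smul_eq_mul]
  ring

lemma integrable_eval_mul_conj_eval {t N : ℝ} (ht0 : 0 ≤ t) (ht1 : t < 1) (hN : 0 < N)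
    (f g : ℂ[X]) :
    Integrable (fun w : ℂ => f.eval w * conj (g.eval w) * (gaussWeight t N w : ℂ)) := by
  have hc := continuous_gaussWeight t N
  induction f using Polynomial.induction_on' with
  | add p q hp hq =>
    refine (hp.add hq).congr (Filter.Eventually.of_forall fun w => ?_)
    simp [add_mul]
  | monomial a x =>
    induction g using Polynomial.induction_on' with
    | add p q hp hq =>
      refine (hp.add hq).congr (Filter.Eventually.of_forall fun w => ?_)
      simp [add_mul, mul_add]
    | monomial b y =>
      refine ((integrable_norm_pow_mul_exp_neg_mul_sq
        (mul_pos hN (sub_pos.2 ht1)) (a + b)).const_mul (‖x‖ * ‖y‖)).mono' ?_ ?_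
      · refine Continuous.aestronglyMeasurable ?_
        simp only [eval_monomial]
        fun_prop
      · refine Filter.Eventually.of_forall fun w => ?_
        simp only [eval_monomial, norm_mul, norm_pow, RCLike.norm_conj, Complex.norm_real,
          Real.norm_of_nonneg (gaussWeight_pos t N w).le]
        calc ‖x‖ * ‖w‖ ^ a * (‖y‖ * ‖w‖ ^ b) * gaussWeight t N w
            = ‖x‖ * ‖y‖ * (‖w‖ ^ (a + b) * gaussWeight t N w) := by ring
          _ ≤ _ := by gcongr; exact gaussWeight_le ht0 hN w

/-! ### The inner product and integration by parts -/

/-- The weighted inner product of two polynomials. -/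
noncomputable def polyInner (t N : ℝ) (f g : ℂ[X]) : ℂ :=
  ∫ w : ℂ, f.eval w * conj (g.eval w) * (gaussWeight t N w : ℂ)

lemma polyInner_add_left {t N : ℝ} (ht0 : 0 ≤ t) (ht1 : t < 1) (hN : 0 < N) (f₁ f₂ g : ℂ[X]) :
    polyInner t N (f₁ + f₂) g = polyInner t N f₁ g + polyInner t N f₂ g := by
  simp only [polyInner]
  rw [← integral_add (integrable_eval_mul_conj_eval ht0 ht1 hN _ _)
    (integrable_eval_mul_conj_eval ht0 ht1 hN _ _)]
  simp [add_mul]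

lemma polyInner_C_mul_left (t N : ℝ) (c : ℂ) (f g : ℂ[X]) :
    polyInner t N (C c * f) g = c * polyInner t N f g := by
  simp only [polyInner]
  rw [← integral_const_mul]
  simp [mul_assoc]

lemma polyInner_conj_symm (t N : ℝ) (f g : ℂ[X]) :
    conj (polyInner t N f g) = polyInner t N g f := by
  simp only [polyInner]
  rw [← integral_conj]
  simp [mul_comm]

lemma polyInner_C_mul_right (t N : ℝ) (c : ℂ) (f g : ℂ[X]) :
    polyInner t N f (C c * g) = conj c * polyInner t N f g := by
  rw [← polyInner_conj_symm, polyInner_C_mul_left, map_mul, polyInner_conj_symm]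

lemma hasLineDerivAt_eval_mul_conj_eval (t N : ℝ) (f g : ℂ[X]) (v w : ℂ) :
    HasLineDerivAt ℝ (fun w : ℂ => f.eval w * conj (g.eval w) * (gaussWeight t N w : ℂ))
      ((v * f.derivative.eval w * conj (g.eval w) + f.eval w * conj (v * g.derivative.eval w)
        - 2 * N * ((1 - t) * w.re * v.re + (1 + t) * w.im * v.im) *
          (f.eval w * conj (g.eval w))) * (gaussWeight t N w : ℂ)) w v := by
  have hline : HasDerivAt (fun s : ℝ => w + s • v) v 0 := by
    simpa using ((hasDerivAt_id (0 : ℝ)).smul_const v).const_add w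
  have hp : ∀ p : ℂ[X], HasDerivAt (fun s : ℝ => p.eval (w + s • v))
      (v * p.derivative.eval w) 0 := fun p => by
    have h := (p.hasDerivAt (w + (0 : ℝ) • v)).scomp (0 : ℝ) hline
    simpa [Function.comp_def] using h
  have hre : HasDerivAt (fun s : ℝ => w.re + s * v.re) v.re 0 := by
    simpa using ((hasDerivAt_id (0 : ℝ)).mul_const v.re).const_add w.re
  have him : HasDerivAt (fun s : ℝ => w.im + s * v.im) v.im 0 := by
    simpa using ((hasDerivAt_id (0 : ℝ)).mul_const v.im).const_add w.im
  have hw : HasDerivAt (fun s : ℝ => ((gaussWeight t N (w + s • v) : ℝ) : ℂ))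
      (((-(2 * N * ((1 - t) * w.re * v.re + (1 + t) * w.im * v.im)) * gaussWeight t N w : ℝ)) : ℂ)
      0 := by
    refine HasDerivAt.ofReal_comp ?_
    have h := ((((hre.pow 2).const_mul (1 - t)).add ((him.pow 2).const_mul (1 + t))).const_mul
      (-N)).exp
    simp only [gaussWeight_eq, Complex.add_re, Complex.add_im, Complex.smul_re, Complex.smul_im,
      smul_eq_mul]
    refine h.congr_deriv ?_
    simp
    ring
  have h := ((hp f).mul (hp g).star).mul hw
  refine h.congr_deriv ?_
  simp
  ring

/-- Integration by parts against the constant function 1. -/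
lemma integral_lineDeriv_eq_zero {F F' : ℂ → ℂ} {v : ℂ} (hF : Integrable F) (hF' : Integrable F')
    (h : ∀ w, HasLineDerivAt ℝ F (F' w) w v) : ∫ w, F' w = 0 := by
  have := integral_bilinear_hasLineDerivAt_right_eq_neg_left_of_integrable (μ := volume)
    (f := F) (f' := F') (g := fun _ : ℂ => (1 : ℂ)) (g' := fun _ => 0) (v := v)
    (B := ContinuousLinearMap.mul ℝ ℂ) (by simpa using hF') (by simp) (by simpa using hF)
    (fun w _ => h w) (fun w _ => by simpa [HasLineDerivAt] using hasDerivAt_const (0 : ℝ) (1 : ℂ))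
  simpa using this

/-- Wick's identity: multiplication by the variable in terms of derivatives. -/
lemma polyInner_X_mul {t N : ℝ} (ht0 : 0 ≤ t) (ht1 : t < 1) (hN : 0 < N) (f g : ℂ[X]) :
    polyInner t N (X * f) g = 1 / (N * (1 - t ^ 2)) * polyInner t N f g.derivative
      + t / (N * (1 - t ^ 2)) * polyInner t N f.derivative g := by
  set A : ℂ → ℂ := fun w => f.derivative.eval w * conj (g.eval w) * (gaussWeight t N w : ℂ)
  set B : ℂ → ℂ := fun w => f.eval w * conj (g.derivative.eval w) * (gaussWeight t N w : ℂ)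
  set D : ℂ → ℂ := fun w => (X * f).eval w * conj (g.eval w) * (gaussWeight t N w : ℂ)
  set E : ℂ → ℂ := fun w => f.eval w * conj ((X * g).eval w) * (gaussWeight t N w : ℂ)
  have hI := integrable_eval_mul_conj_eval ht0 ht1 hN
  have hA : Integrable A := hI _ _
  have hB : Integrable B := hI _ _
  have hD : Integrable D := hI _ _
  have hE : Integrable E := hI _ _
  have hre : ∀ w : ℂ, (w.re : ℂ) = (w + conj w) / 2 := fun w => by
    rw [Complex.add_conj]; push_cast; ring
  have him : ∀ w : ℂ, (w.im : ℂ) = -Complex.I * (w - conj w) / 2 := fun w => by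
    rw [Complex.sub_conj]; push_cast; linear_combination (w.im : ℂ) * Complex.I_sq
  -- The directions `1` and `I` give two linear relations between the integrals of `A`, `B`, `D`,
  -- `E`; `key` is the combination that eliminates `E`.
  have h1 : ∫ w, (A w + B w - N * (1 - t) * (D w + E w)) = 0 := by
    refine integral_lineDeriv_eq_zero (v := 1) (hI f g) (by fun_prop) fun w => ?_
    convert hasLineDerivAt_eval_mul_conj_eval t N f g 1 w using 1
    simp [A, B, D, E, hre]
    ring
  have h2 : ∫ w, (Complex.I * (A w - B w + N * (1 + t) * (D w - E w))) = 0 := by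
    refine integral_lineDeriv_eq_zero (v := Complex.I) (hI f g) (by fun_prop) fun w => ?_
    convert hasLineDerivAt_eval_mul_conj_eval t N f g Complex.I w using 1
    simp [A, B, D, E, him]
    ring
  rw [integral_const_mul] at h2
  rw [integral_sub (by fun_prop) (by fun_prop), integral_add hA hB, integral_const_mul,
    integral_add hD hE] at h1
  have h2' := (mul_eq_zero.1 h2).resolve_left Complex.I_ne_zero
  rw [integral_add (by fun_prop) (by fun_prop), integral_sub hA hB, integral_const_mul,
    integral_sub hD hE] at h2'
  change (∫ w, D w) = _ * (∫ w, B w) + _ * (∫ w, A w)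
  have hne : (N : ℂ) * (1 - t ^ 2) ≠ 0 := by
    have : N * (1 - t ^ 2) ≠ 0 := (mul_pos hN (by nlinarith)).ne'
    exact_mod_cast this
  have key : ((N : ℂ) * (1 - t ^ 2)) * (∫ w, D w) = (∫ w, B w) + t * ∫ w, A w := by
    linear_combination (-(1 + t) / 2 : ℂ) * h1 + (1 - t) / 2 * h2'
  rw [eq_div_of_mul_eq hne ((mul_comm _ _).trans key)]
  ring

/-! ### Hermite polynomials and their orthogonality -/

/-- The monic Hermite polynomials with variance `τ`. -/
noncomputable def hermiteMonic (τ : ℂ) : ℕ → ℂ[X]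
  | 0 => 1
  | k + 1 => X * hermiteMonic τ k - C τ * derivative (hermiteMonic τ k)

lemma derivative_hermiteMonic_succ (τ : ℂ) (k : ℕ) :
    derivative (hermiteMonic τ (k + 1)) = C ((k : ℂ) + 1) * hermiteMonic τ k := by
  induction k with
  | zero => simp [hermiteMonic]
  | succ k ih =>
    rw [hermiteMonic]
    simp only [derivative_sub, derivative_mul, derivative_X, derivative_C]
    rw [ih]
    simp only [derivative_mul, derivative_C]
    rw [hermiteMonic]
    simp only [map_add, map_one, Nat.cast_add, Nat.cast_one]
    ring

lemma hermiteMonic_succ_succ (τ : ℂ) (k : ℕ) :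
    hermiteMonic τ (k + 2) =
      X * hermiteMonic τ (k + 1) - C (τ * ((k : ℂ) + 1)) * hermiteMonic τ k := by
  rw [hermiteMonic, derivative_hermiteMonic_succ, map_mul]
  ring

lemma degree_hermiteMonic (τ : ℂ) (k : ℕ) : (hermiteMonic τ k).degree = k := by
  induction k with
  | zero => simp [hermiteMonic]
  | succ k ih =>
    have hX : (X * hermiteMonic τ k).degree = ((k + 1 : ℕ) : WithBot ℕ) := by
      rw [degree_mul, degree_X, ih]; push_cast; ring
    rw [hermiteMonic, degree_sub_eq_left_of_degree_lt, hX]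
    calc (C τ * derivative (hermiteMonic τ k)).degree
        ≤ (derivative (hermiteMonic τ k)).degree := by
          rw [degree_mul]
          by_cases h : τ = 0 <;> simp [h]
      _ ≤ (hermiteMonic τ k).degree := degree_derivative_le
      _ < _ := by rw [hX, ih]; exact_mod_cast k.lt_succ_self

/-- This variance makes the `f'` term of Wick's identity cancel: `X - τ d/dz` is the adjoint of
`d/dz` up to the factor `1 / (N (1 - t²))`. Orthogonality and norms follow by moving derivatives
onto `g`. -/
lemma polyInner_hermiteMonic_succ {t N : ℝ} (ht0 : 0 ≤ t) (ht1 : t < 1) (hN : 0 < N) (k : ℕ)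
    (g : ℂ[X]) :
    polyInner t N (hermiteMonic (t / (N * (1 - t ^ 2))) (k + 1)) g =
      1 / (N * (1 - t ^ 2)) *
        polyInner t N (hermiteMonic (t / (N * (1 - t ^ 2))) k) (derivative g) := by
  have h := polyInner_add_left ht0 ht1 hN (X * hermiteMonic (t / (N * (1 - t ^ 2))) k)
    (C (-(t / (N * (1 - t ^ 2)) : ℂ)) * derivative (hermiteMonic (t / (N * (1 - t ^ 2))) k)) g
  rw [polyInner_C_mul_left, polyInner_X_mul ht0 ht1 hN] at h
  rw [hermiteMonic, sub_eq_add_neg, ← neg_mul, ← C_neg, h]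
  ring

lemma polyInner_zero_right (t N : ℝ) (f : ℂ[X]) : polyInner t N f 0 = 0 := by
  simp [polyInner]

/-- The total mass of the weight. -/
noncomputable def gaussMass (t N : ℝ) : ℝ := ∫ w : ℂ, gaussWeight t N w

lemma polyInner_one_one (t N : ℝ) : polyInner t N 1 1 = gaussMass t N := by
  simp [polyInner, gaussMass, integral_complex_ofReal]

lemma gaussMass_pos {t N : ℝ} (ht0 : 0 ≤ t) (ht1 : t < 1) (hN : 0 < N) : 0 < gaussMass t N := by
  have hi : Integrable (gaussWeight t N) := by
    have := (integrable_eval_mul_conj_eval ht0 ht1 hN 1 1).re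
    simpa using this
  exact integral_pos_of_integrable_nonneg_nonzero (x := 0) (continuous_gaussWeight t N) hi
    (fun w => (gaussWeight_pos t N w).le) (gaussWeight_pos t N 0).ne'

lemma polyInner_hermiteMonic_of_degree_lt {t N : ℝ} (ht0 : 0 ≤ t) (ht1 : t < 1) (hN : 0 < N)
    (k : ℕ) (g : ℂ[X]) (hg : g.degree < k) :
    polyInner t N (hermiteMonic (t / (N * (1 - t ^ 2))) k) g = 0 := by
  induction k generalizing g with
  | zero =>
    have : g = 0 := by simpa [Nat.WithBot.lt_zero_iff] using hg
    rw [this, polyInner_zero_right]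
  | succ k ih =>
    rw [polyInner_hermiteMonic_succ ht0 ht1 hN]
    by_cases h0 : g = 0
    · simp [h0, polyInner_zero_right]
    have hd := degree_derivative_lt h0
    rw [ih _ (lt_of_lt_of_le hd ?_), mul_zero]
    rw [degree_eq_natDegree h0] at hg ⊢
    exact_mod_cast Nat.lt_succ_iff.1 (by exact_mod_cast hg)

/-- The squared norm of the monic Hermite polynomial of degree `k`. -/
noncomputable def hermiteNormSq (t N : ℝ) (k : ℕ) : ℝ :=
  k.factorial * (1 / (N * (1 - t ^ 2))) ^ k * gaussMass t N

lemma hermiteNormSq_pos {t N : ℝ} (ht0 : 0 ≤ t) (ht1 : t < 1) (hN : 0 < N) (k : ℕ) :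
    0 < hermiteNormSq t N k := by
  have h1 : 0 < N * (1 - t ^ 2) := mul_pos hN (by nlinarith)
  have := gaussMass_pos ht0 ht1 hN
  unfold hermiteNormSq
  positivity

lemma polyInner_hermiteMonic_self {t N : ℝ} (ht0 : 0 ≤ t) (ht1 : t < 1) (hN : 0 < N) (k : ℕ) :
    polyInner t N (hermiteMonic (t / (N * (1 - t ^ 2))) k)
      (hermiteMonic (t / (N * (1 - t ^ 2))) k) = hermiteNormSq t N k := by
  induction k with
  | zero => simp [hermiteMonic, polyInner_one_one, hermiteNormSq]
  | succ k ih =>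
    rw [polyInner_hermiteMonic_succ ht0 ht1 hN, derivative_hermiteMonic_succ,
      polyInner_C_mul_right, ih, hermiteNormSq, hermiteNormSq, Nat.factorial_succ]
    simp
    ring

lemma polyInner_hermiteMonic_of_ne {t N : ℝ} (ht0 : 0 ≤ t) (ht1 : t < 1) (hN : 0 < N) {j k : ℕ}
    (hjk : j ≠ k) :
    polyInner t N (hermiteMonic (t / (N * (1 - t ^ 2))) j)
      (hermiteMonic (t / (N * (1 - t ^ 2))) k) = 0 := by
  rcases hjk.lt_or_gt with h | h
  · rw [← polyInner_conj_symm, polyInner_hermiteMonic_of_degree_lt ht0 ht1 hN, map_zero]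
    rw [degree_hermiteMonic]
    exact_mod_cast h
  · rw [polyInner_hermiteMonic_of_degree_lt ht0 ht1 hN]
    rw [degree_hermiteMonic]
    exact_mod_cast h

lemma integral_eval_mul_conj_eval_eq_polyInner (t N : ℝ) (f g : ℂ[X]) :
    ∫ z : ℂ, f.eval z * conj (g.eval z) *
      (weight (potential (fun z => (t : ℂ) * z ^ 2 / 2)) N z : ℂ) = polyInner t N f g := rfl

lemma exists_isOrthonormalPolynomials {t N : ℝ} (ht0 : 0 ≤ t) (ht1 : t < 1) (hN : 0 < N) :
    ∃ p : ℕ → ℂ[X],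
      IsOrthonormalPolynomials (potential (fun z => (t : ℂ) * z ^ 2 / 2)) N p := by
  have hpos := hermiteNormSq_pos ht0 ht1 hN
  refine ⟨fun k => C (((√(hermiteNormSq t N k))⁻¹ : ℝ) : ℂ) *
    hermiteMonic (t / (N * (1 - t ^ 2))) k, ⟨fun k => ?_, fun j k => ?_⟩⟩
  · rw [degree_mul, degree_C, degree_hermiteMonic, zero_add]
    exact_mod_cast (inv_pos.2 (Real.sqrt_pos.2 (hpos k))).ne'
  · rw [integral_eval_mul_conj_eval_eq_polyInner, polyInner_C_mul_left, polyInner_C_mul_right,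
      Complex.conj_ofReal]
    split_ifs with h
    · subst h
      rw [polyInner_hermiteMonic_self ht0 ht1 hN]
      norm_cast
      rw [← mul_assoc, ← mul_inv, Real.mul_self_sqrt (hpos j).le, inv_mul_cancel₀ (hpos j).ne']
    · rw [polyInner_hermiteMonic_of_ne ht0 ht1 hN h]
      simp

/-! ### Uniqueness of the orthonormal polynomials up to phase -/

section Orthonormal

variable {t N : ℝ} {p : ℕ → ℂ[X]}

lemma IsOrthonormalPolynomials.polyInner_eq
    (hp : IsOrthonormalPolynomials (potential (fun z => (t : ℂ) * z ^ 2 / 2)) N p) (j k : ℕ) :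
    polyInner t N (p j) (p k) = if j = k then 1 else 0 := hp.integral_eq j k

/-- Since the degrees are exact, `p 0, …, p (n - 1)` span all polynomials of degree below `n`. -/
lemma IsOrthonormalPolynomials.polyInner_of_degree_lt (ht0 : 0 ≤ t) (ht1 : t < 1) (hN : 0 < N)
    (hp : IsOrthonormalPolynomials (potential (fun z => (t : ℂ) * z ^ 2 / 2)) N p) {n : ℕ}
    {f : ℂ[X]} (hf : f.degree < n) : polyInner t N f (p n) = 0 := by
  let S : Polynomial.Sequence ℂ := ⟨p, hp.degree_eq⟩
  have hmem : f ∈ Submodule.span ℂ (S '' Set.Iio n) := by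
    rw [S.span_degreeLT (fun i _ => (leadingCoeff_ne_zero.2 (S.ne_zero i)).isUnit), mem_degreeLT]
    exact hf
  clear hf
  induction hmem using Submodule.span_induction with
  | mem x hx =>
    obtain ⟨i, hi, rfl⟩ := hx
    exact (hp.polyInner_eq i n).trans (if_neg (ne_of_lt hi))
  | zero => simp [polyInner]
  | add x y _ _ hx hy => rw [polyInner_add_left ht0 ht1 hN, hx, hy, add_zero]
  | smul a x _ hx => rw [smul_eq_C_mul, polyInner_C_mul_left, hx, mul_zero]

lemma integrable_norm_eval_sq (ht0 : 0 ≤ t) (ht1 : t < 1) (hN : 0 < N) (f : ℂ[X]) :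
    Integrable (fun w : ℂ => ‖f.eval w‖ ^ 2 * gaussWeight t N w) := by
  refine (integrable_eval_mul_conj_eval ht0 ht1 hN f f).re.congr
    (Filter.Eventually.of_forall fun w => ?_)
  simp only [Complex.mul_conj']
  norm_cast

lemma polyInner_self (t N : ℝ) (f : ℂ[X]) :
    polyInner t N f f = ((∫ w : ℂ, ‖f.eval w‖ ^ 2 * gaussWeight t N w : ℝ) : ℂ) := by
  rw [← integral_complex_ofReal, polyInner]
  simp [Complex.mul_conj']

lemma eq_zero_of_polyInner_self (ht0 : 0 ≤ t) (ht1 : t < 1) (hN : 0 < N) {f : ℂ[X]}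
    (h : polyInner t N f f = 0) : f = 0 := by
  by_contra hf
  obtain ⟨x, hx⟩ : ∃ x, f.eval x ≠ 0 := by
    by_contra! hall
    exact hf (Polynomial.funext (by simpa using hall))
  have hw := gaussWeight_pos t N
  have hc := continuous_gaussWeight t N
  have hpos : 0 < ∫ w : ℂ, ‖f.eval w‖ ^ 2 * gaussWeight t N w :=
    integral_pos_of_integrable_nonneg_nonzero (x := x) (by fun_prop)
      (integrable_norm_eval_sq ht0 ht1 hN f) (fun w => mul_nonneg (by positivity) (hw w).le)
      (mul_pos (by positivity) (hw x)).ne'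
  rw [polyInner_self] at h
  exact hpos.ne' (by exact_mod_cast h)

/-- Matching leading coefficients leaves a difference `D` of degree below `n`. It is orthogonal to
both polynomials, hence to itself, hence zero. -/
lemma IsOrthonormalPolynomials.exists_eq_C_mul (ht0 : 0 ≤ t) (ht1 : t < 1) (hN : 0 < N)
    (hp : IsOrthonormalPolynomials (potential (fun z => (t : ℂ) * z ^ 2 / 2)) N p) (n : ℕ) :
    ∃ c : ℂ, ‖c‖ ^ 2 * hermiteNormSq t N n = 1 ∧
      p n = C c * hermiteMonic (t / (N * (1 - t ^ 2))) n := by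
  set P := hermiteMonic (t / (N * (1 - t ^ 2))) n with hP
  have hPdeg : P.degree = n := degree_hermiteMonic _ n
  have hP0 : P.leadingCoeff ≠ 0 := by
    rw [leadingCoeff_ne_zero, ← degree_ne_bot, hPdeg]; simp
  have hp0 : p n ≠ 0 := by rw [← degree_ne_bot, hp.degree_eq]; simp
  set a := (p n).leadingCoeff / P.leadingCoeff with ha
  have ha0 : a ≠ 0 := div_ne_zero (leadingCoeff_ne_zero.2 hp0) hP0
  set D := p n + C (-a) * P with hD
  have hDdeg : D.degree < n := by
    have : D = p n - C a * P := by rw [hD, C_neg, neg_mul, sub_eq_add_neg]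
    rw [this, ← hp.degree_eq n]
    refine degree_sub_lt_left ?_ hp0 ?_
    · rw [degree_C_mul ha0, hPdeg, hp.degree_eq]
    · rw [leadingCoeff_mul, leadingCoeff_C, ha, div_mul_cancel₀ _ hP0]
  have hD0 : D = 0 := by
    refine eq_zero_of_polyInner_self ht0 ht1 hN (t := t) (N := N) ?_
    conv_lhs => rw [hD]
    rw [polyInner_add_left ht0 ht1 hN, polyInner_C_mul_left, ← hD,
      polyInner_hermiteMonic_of_degree_lt ht0 ht1 hN n D hDdeg, ← polyInner_conj_symm,
      hp.polyInner_of_degree_lt ht0 ht1 hN hDdeg]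
    simp
  have hpn : p n = C a * P := by
    rw [hD, C_neg, neg_mul, ← sub_eq_add_neg] at hD0
    exact sub_eq_zero.1 hD0
  refine ⟨a, ?_, hpn⟩
  have h := hp.polyInner_eq n n
  rw [if_pos rfl, hpn, polyInner_C_mul_left, polyInner_C_mul_right, hP,
    polyInner_hermiteMonic_self ht0 ht1 hN, ← mul_assoc, Complex.mul_conj'] at h
  exact_mod_cast h

end Orthonormal

/-! ### The ellipse and the unit disk -/

/-- A dilate `s z` with `s > 1` is still in the droplet, and the quadratic form scales by `s²`. -/
lemma re_sq_add_im_sq_lt_of_mem_interior_droplet {t T : ℝ} (hT : 0 < T) {z : ℂ} (hz : z ∈ interior (droplet t T)) :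
    (1 - t) / (1 + t) * z.re ^ 2 + (1 + t) / (1 - t) * z.im ^ 2 < T := by
  have hcont : Continuous fun s : ℝ => ((s : ℂ) * z) := by fun_prop
  have hmem : ∀ᶠ s : ℝ in nhds 1, (s : ℂ) * z ∈ interior (droplet t T) :=
    hcont.continuousAt.eventually_mem (by simpa using isOpen_interior.mem_nhds hz)
  obtain ⟨s, hs, hs1⟩ := ((hmem.filter_mono nhdsWithin_le_nhds).and
    (self_mem_nhdsWithin : Set.Ioi (1 : ℝ) ∈ nhdsWithin 1 (Set.Ioi 1))).exists
  have h : (1 - t) / (1 + t) * (s * z.re) ^ 2 + (1 + t) / (1 - t) * (s * z.im) ^ 2 ≤ T := by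
    simpa [droplet] using interior_subset hs
  have hs1' : (1 : ℝ) < s := hs1
  set q := (1 - t) / (1 + t) * z.re ^ 2 + (1 + t) / (1 - t) * z.im ^ 2 with hq
  have h' : s ^ 2 * q ≤ T := by rw [hq]; linarith
  by_contra! hge
  have h2 : 0 < (s - 1) * T := mul_pos (by linarith) hT
  nlinarith [mul_le_mul_of_nonneg_left hge (sq_nonneg s)]

/-- Inside the ellipse that is the image of the unit circle under `l ↦ l + t / l`, the preimages
lie in the open unit disk. -/
lemma norm_lt_one_of_joukowski {t : ℝ} (ht0 : 0 ≤ t) (ht1 : t < 1) {a l : ℂ}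
    (ha : (1 - t) ^ 2 * a.re ^ 2 + (1 + t) ^ 2 * a.im ^ 2 < (1 - t ^ 2) ^ 2)
    (hl : l ^ 2 - a * l + t = 0) : ‖l‖ < 1 := by
  by_contra! hge
  set x := l.re
  set y := l.im
  set r := x ^ 2 + y ^ 2 with hr
  have hr1 : 1 ≤ r := by
    have : r = ‖l‖ ^ 2 := by rw [Complex.sq_norm, Complex.normSq_apply, hr]; ring
    rw [this]; nlinarith
  have hre : x ^ 2 - y ^ 2 - (a.re * x - a.im * y) + t = 0 := by
    have := congrArg Complex.re hl
    simp [pow_two] at this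
    simp only [x, y]; linarith
  have him : 2 * x * y - (a.re * y + a.im * x) = 0 := by
    have := congrArg Complex.im hl
    simp [pow_two] at this
    simp only [x, y]; linarith
  -- These are the real and imaginary parts of `a = l + t / l`, multiplied by `r = |l|²`.
  have h1 : a.re * r = x * (r + t) := by rw [hr]; linear_combination (-x) * hre - y * him
  have h2 : a.im * r = y * (r - t) := by rw [hr]; linear_combination y * hre - x * him
  -- This product is both `(r + t)² - (1 + t)² r` and `(r - t)² - (1 - t)² r`.
  have h0 : 0 ≤ (r - 1) * (r - t ^ 2) := mul_nonneg (by linarith) (by nlinarith)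
  have h3 : (1 + t) ^ 2 * r ≤ (r + t) ^ 2 := by linarith
  have h4 : (1 - t) ^ 2 * r ≤ (r - t) ^ 2 := by linarith
  have h5 : ((1 - t) ^ 2 * a.re ^ 2 + (1 + t) ^ 2 * a.im ^ 2) * r ^ 2 =
      (1 - t) ^ 2 * x ^ 2 * (r + t) ^ 2 + (1 + t) ^ 2 * y ^ 2 * (r - t) ^ 2 := by
    linear_combination (1 - t) ^ 2 * (a.re * r + x * (r + t)) * h1
      + (1 + t) ^ 2 * (a.im * r + y * (r - t)) * h2
  have h6 : (1 - t ^ 2) ^ 2 * r ^ 2 ≤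
      (1 - t) ^ 2 * x ^ 2 * (r + t) ^ 2 + (1 + t) ^ 2 * y ^ 2 * (r - t) ^ 2 := by
    have e1 := mul_le_mul_of_nonneg_left h3 (mul_nonneg (sq_nonneg (1 - t)) (sq_nonneg x))
    have e2 := mul_le_mul_of_nonneg_left h4 (mul_nonneg (sq_nonneg (1 + t)) (sq_nonneg y))
    have e3 : (1 - t) ^ 2 * x ^ 2 * ((1 + t) ^ 2 * r) + (1 + t) ^ 2 * y ^ 2 * ((1 - t) ^ 2 * r)
      = (1 - t ^ 2) ^ 2 * r ^ 2 := by rw [hr]; ring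
    linarith
  have : 0 < r ^ 2 := by positivity
  nlinarith

/-! ### Perturbed contracting recurrences -/

/-- Solutions of a small perturbation of a contracting linear recurrence of order two decay
exponentially. -/
lemma exists_decay_of_recurrence {l₁ l₂ : ℂ} (h₁ : ‖l₁‖ < 1) (h₂ : ‖l₂‖ < 1) :
    ∃ η > (0 : ℝ), ∃ q : ℝ, 0 < q ∧ q < 1 ∧ ∃ A > (0 : ℝ), ∀ (y : ℕ → ℂ) (m j : ℕ),
      (∀ k, m ≤ k → k < m + j → ‖y (k + 2) - ((l₁ + l₂) * y (k + 1) - l₁ * l₂ * y k)‖ ≤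
        η * (‖y k‖ + ‖y (k + 1)‖)) →
      ‖y (m + j)‖ ≤ A * q ^ j * (‖y m‖ + ‖y (m + 1)‖) := by
  set r := max ‖l₁‖ ‖l₂‖ with hr
  have hr0 : 0 ≤ r := (norm_nonneg _).trans (le_max_left _ _)
  have hr1 : r < 1 := max_lt h₁ h₂
  have hl1 : ‖l₁‖ ≤ r := le_max_left _ _
  have hl2 : ‖l₂‖ ≤ r := le_max_right _ _
  set d := (1 - r) / 3 with hd
  have hd0 : 0 < d := by rw [hd]; linarith
  set M := 1 / d with hM
  have hM0 : 0 < M := by positivity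
  have hMd : M * d = 1 := by rw [hM]; field_simp
  have hM1 : 1 ≤ M := by rw [hM, le_div_iff₀ hd0]; linarith
  set η := d / (2 * M) with hη
  have hη0 : 0 < η := by positivity
  have hMη : M * η * 2 = d := by rw [hη]; field_simp
  refine ⟨η, hη0, 1 - d, by linarith, by linarith, 1 + 2 * M, by positivity, ?_⟩
  intro y m j hj
  -- The difference `u_k = y_{k+1} - l₂ y_k` decouples the recurrence: `u_{k+1} ≈ l₁ u_k` and
  -- `y_{k+1} = l₂ y_k + u_k`. The weight `M = 1/d` lets the contraction of `u` absorb the `u_k` fed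
  -- into `y`, and `2 M η = d` controls the perturbation, so `ν` shrinks by `1 - d` per step.
  set ν : ℕ → ℝ := fun k => ‖y k‖ + M * ‖y (k + 1) - l₂ * y k‖ with hν
  have hνm : ν m ≤ (1 + 2 * M) * (‖y m‖ + ‖y (m + 1)‖) := by
    have : ‖y (m + 1) - l₂ * y m‖ ≤ ‖y (m + 1)‖ + ‖y m‖ := by
      refine (norm_sub_le _ _).trans ?_
      rw [norm_mul]
      have := mul_le_mul_of_nonneg_right h₂.le (norm_nonneg (y m))
      linarith
    have h2 := mul_le_mul_of_nonneg_left this hM0.le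
    simp only [hν]
    nlinarith [norm_nonneg (y m), norm_nonneg (y (m + 1)),
      mul_nonneg hM0.le (norm_nonneg (y m)), mul_nonneg hM0.le (norm_nonneg (y (m + 1)))]
  have hstep : ∀ i, i ≤ j → ν (m + i) ≤ (1 - d) ^ i * ν m := by
    intro i
    induction i with
    | zero => intro _; simp
    | succ i ih =>
      intro hi
      have ih' := ih (by omega)
      have hk := hj (m + i) (by omega) (by omega)
      set a := y (m + i)
      set b := y (m + i + 1)
      set c := y (m + i + 2)
      have hb : ‖b‖ ≤ r * ‖a‖ + ‖b - l₂ * a‖ := by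
        have : b = l₂ * a + (b - l₂ * a) := by ring
        calc ‖b‖ = ‖l₂ * a + (b - l₂ * a)‖ := by rw [← this]
          _ ≤ ‖l₂ * a‖ + ‖b - l₂ * a‖ := norm_add_le _ _
          _ ≤ _ := by rw [norm_mul]; gcongr
      have hc : ‖c - l₂ * b‖ ≤ r * ‖b - l₂ * a‖ + η * (‖a‖ + ‖b‖) := by
        have : c - l₂ * b = l₁ * (b - l₂ * a) + (c - ((l₁ + l₂) * b - l₁ * l₂ * a)) := by ring
        rw [this]
        refine (norm_add_le _ _).trans ?_
        rw [norm_mul]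
        gcongr
      have hgoal : ν (m + (i + 1)) ≤ (1 - d) * ν (m + i) := by
        change ‖b‖ + M * ‖c - l₂ * b‖ ≤ (1 - d) * (‖a‖ + M * ‖b - l₂ * a‖)
        set u := ‖b - l₂ * a‖
        have hu0 : 0 ≤ u := norm_nonneg _
        have ha0 : 0 ≤ ‖a‖ := norm_nonneg _
        have hb' : ‖b‖ ≤ ‖a‖ + u := by nlinarith
        have hc' : M * ‖c - l₂ * b‖ ≤ M * r * u + d * (‖a‖ + u) := by
          have h1 := mul_le_mul_of_nonneg_left hc hM0.le
          have h2 : M * η * (‖a‖ + ‖b‖) ≤ M * η * (2 * (‖a‖ + u)) :=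
            mul_le_mul_of_nonneg_left (by linarith) (by positivity)
          have h3 : M * η * (2 * (‖a‖ + u)) = d * (‖a‖ + u) := by rw [← hMη]; ring
          linarith
        have hrd : r = 1 - 3 * d := by rw [hd]; ring
        have e1 : M * r * u = M * u - 3 * u := by
          rw [hrd]; linear_combination (-3 * u) * hMd
        have e2 : (1 - d) * (M * u) = M * u - u := by linear_combination (-u) * hMd
        have hd1 : d ≤ 1 := by rw [hd]; linarith
        rw [hrd] at hb
        nlinarith [mul_nonneg hd0.le ha0, mul_le_mul_of_nonneg_right hd1 hu0]
      calc ν (m + (i + 1)) ≤ (1 - d) * ν (m + i) := hgoal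
        _ ≤ (1 - d) * ((1 - d) ^ i * ν m) := by
          refine mul_le_mul_of_nonneg_left ih' ?_; linarith
        _ = _ := by ring
  calc ‖y (m + j)‖ ≤ ν (m + j) := by
        simp only [hν]; linarith [mul_nonneg hM0.le (norm_nonneg (y (m + j + 1) - l₂ * y (m + j)))]
    _ ≤ (1 - d) ^ j * ν m := hstep j le_rfl
    _ ≤ (1 - d) ^ j * ((1 + 2 * M) * (‖y m‖ + ‖y (m + 1)‖)) := by
      refine mul_le_mul_of_nonneg_left hνm (pow_nonneg ?_ _); linarith
    _ = _ := by ring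

/-! ### Mean values and pointwise bounds -/

lemma setIntegral_closedBall_comp_rotation (h : ℂ → ℂ) (ρ θ : ℝ) :
    ∫ w in Metric.closedBall (0 : ℂ) ρ, h (circleMap 0 1 θ * w) =
      ∫ w in Metric.closedBall (0 : ℂ) ρ, h w := by
  have hmp := (rotation (Circle.exp θ)).measurePreserving
  have h1 := hmp.setIntegral_preimage_emb
    (rotation (Circle.exp θ)).toHomeomorph.measurableEmbedding h (Metric.closedBall (0 : ℂ) ρ)
  have h2 : (rotation (Circle.exp θ)) ⁻¹' (Metric.closedBall (0 : ℂ) ρ) =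
      Metric.closedBall (0 : ℂ) ρ := by
    rw [LinearIsometryEquiv.preimage_closedBall, map_zero]
  rw [h2] at h1
  rw [← h1]
  simp [circleMap, rotation_apply, Circle.coe_exp]

/-- Area mean value property of entire functions. -/
lemma setIntegral_closedBall_of_differentiable {h : ℂ → ℂ} (hh : Differentiable ℂ h) {ρ : ℝ}
    (hρ : 0 ≤ ρ) :
    ∫ w in Metric.closedBall (0 : ℂ) ρ, h w = (Real.pi * ρ ^ 2 : ℝ) * h 0 := by
  have hcont := hh.continuous
  have hmv : ∀ w : ℂ, ∫ θ in Set.Ioc 0 (2 * Real.pi), h (circleMap 0 1 θ * w) =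
      2 * Real.pi * h 0 := by
    intro w
    have hd : Differentiable ℂ fun ζ : ℂ => h (ζ * w) := by fun_prop
    have := hd.diffContOnCl.circleAverage (c := 0) (R := 1)
    rw [Real.circleAverage, intervalIntegral.integral_of_le (by positivity)] at this
    rw [inv_smul_eq_iff₀ (by positivity)] at this
    simpa using this
  -- Fubini for `h(e^{iθ} w)`: integrating first over the disk gives the same value for every `θ`,
  -- integrating first over `θ` gives `2π h(0)` for every `w`.
  have hint : Integrable (Function.uncurry fun (θ : ℝ) (w : ℂ) => h (circleMap 0 1 θ * w))
      ((volume.restrict (Set.Ioc 0 (2 * Real.pi))).prod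
        (volume.restrict (Metric.closedBall (0 : ℂ) ρ))) := by
    rw [Measure.prod_restrict]
    have : IntegrableOn (Function.uncurry fun (θ : ℝ) (w : ℂ) => h (circleMap 0 1 θ * w))
        (Set.Icc 0 (2 * Real.pi) ×ˢ Metric.closedBall (0 : ℂ) ρ) (volume.prod volume) := by
      refine ContinuousOn.integrableOn_compact (isCompact_Icc.prod (isCompact_closedBall _ _)) ?_
      refine Continuous.continuousOn ?_
      have := continuous_circleMap 0 1
      simp only [Function.uncurry_def]
      fun_prop
    exact this.mono_set (Set.prod_mono Set.Ioc_subset_Icc_self subset_rfl)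
  have hswap := integral_integral_swap hint
  simp only [setIntegral_closedBall_comp_rotation, hmv, integral_const,
    measureReal_restrict_apply_univ, Complex.real_smul] at hswap
  have hv : (volume : Measure ℂ).real (Metric.closedBall 0 ρ) = Real.pi * ρ ^ 2 := by
    rw [measureReal_def, Complex.volume_closedBall]
    simp [ENNReal.toReal_ofReal hρ]
    ring
  rw [hv, Real.volume_real_Ioc_of_le (by positivity), sub_zero] at hswap
  have hpi : ((2 * Real.pi : ℝ) : ℂ) ≠ 0 := by exact_mod_cast Real.two_pi_pos.ne'
  apply mul_left_cancel₀ hpi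
  rw [hswap]
  push_cast
  ring

lemma norm_mul_le_setIntegral_closedBall {h : ℂ → ℂ} (hh : Differentiable ℂ h) {ρ : ℝ}
    (hρ : 0 ≤ ρ) :
    Real.pi * ρ ^ 2 * ‖h 0‖ ≤ ∫ w in Metric.closedBall (0 : ℂ) ρ, ‖h w‖ := by
  have := norm_integral_le_integral_norm (μ := volume.restrict (Metric.closedBall (0 : ℂ) ρ)) h
  rw [setIntegral_closedBall_of_differentiable hh hρ, norm_mul, Complex.norm_real,
    Real.norm_of_nonneg (by positivity)] at this
  exact this

/-- Pointwise bound of a weighted polynomial by its weighted `L²` norm. -/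
lemma norm_eval_sq_mul_gaussWeight_le {t N : ℝ} (ht0 : 0 ≤ t) (ht1 : t < 1) (hN : 0 < N)
    (f : ℂ[X]) (w : ℂ) :
    ‖f.eval w‖ ^ 2 * gaussWeight t N w ≤
      N * (Real.exp 1 / Real.pi) * ∫ w : ℂ, ‖f.eval w‖ ^ 2 * gaussWeight t N w := by
  set F : ℂ → ℝ := fun w => ‖f.eval w‖ ^ 2 * gaussWeight t N w with hF
  have hFi : Integrable F := integrable_norm_eval_sq ht0 ht1 hN f
  have hF0 : ∀ w, 0 ≤ F w := fun w => mul_nonneg (by positivity) (gaussWeight_pos t N w).le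
  -- An entire function with modulus `F (w + ζ) e^{N|ζ|²}`: apart from `|ζ|²`, the potential at `w +
  -- ζ` is the real part of a polynomial in `ζ`. On the disk of radius `N^{-1/2}` the extra factor
  -- is at most `e`.
  set h : ℂ → ℂ := fun ζ => f.eval (w + ζ) ^ 2 *
    Complex.exp (N * (t * (w + ζ) ^ 2 - 2 * conj w * ζ - w * conj w)) with hh
  have hd : Differentiable ℂ h := by fun_prop
  have hnorm : ∀ ζ, ‖h ζ‖ = F (w + ζ) * Real.exp (N * ‖ζ‖ ^ 2) := by
    intro ζ
    simp only [hh, hF]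
    rw [norm_mul, norm_pow, Complex.norm_exp, gaussWeight_eq, mul_assoc (‖_‖ ^ 2), ← Real.exp_add,
      Complex.sq_norm ζ, Complex.normSq_apply, Complex.re_ofReal_mul]
    congr 2
    simp [pow_two]
    ring
  have h0 : ‖h 0‖ = F w := by rw [hnorm]; simp
  have hsq : (√N)⁻¹ ^ 2 = N⁻¹ := by rw [inv_pow, Real.sq_sqrt hN.le]
  have hmv := norm_mul_le_setIntegral_closedBall hd (ρ := (√N)⁻¹) (by positivity)
  have hle : ∫ ζ in Metric.closedBall (0 : ℂ) (√N)⁻¹, ‖h ζ‖ ≤ Real.exp 1 * ∫ w, F w := by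
    have hshift : Integrable fun ζ => F (w + ζ) := hFi.comp_add_left w
    calc ∫ ζ in Metric.closedBall (0 : ℂ) (√N)⁻¹, ‖h ζ‖
        ≤ ∫ ζ in Metric.closedBall (0 : ℂ) (√N)⁻¹, Real.exp 1 * F (w + ζ) := by
          refine setIntegral_mono_on ?_ (hshift.const_mul _).integrableOn
            measurableSet_closedBall fun ζ hζ => ?_
          · exact hd.continuous.norm.continuousOn.integrableOn_compact (isCompact_closedBall _ _)
          · rw [hnorm, mul_comm]
            refine mul_le_mul_of_nonneg_right (Real.exp_le_exp.2 ?_) (hF0 _)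
            have hζ' : ‖ζ‖ ≤ (√N)⁻¹ := by simpa using hζ
            calc N * ‖ζ‖ ^ 2 ≤ N * (√N)⁻¹ ^ 2 := by gcongr
              _ = 1 := by rw [hsq, mul_inv_cancel₀ hN.ne']
      _ ≤ ∫ ζ, Real.exp 1 * F (w + ζ) :=
          setIntegral_le_integral (hshift.const_mul _)
            (Filter.Eventually.of_forall fun ζ => mul_nonneg (Real.exp_pos _).le (hF0 _))
      _ = _ := by rw [integral_const_mul, integral_add_left_eq_self F w]
  rw [h0, hsq] at hmv
  have := hmv.trans hle
  change F w ≤ _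
  rw [← div_eq_mul_inv, div_mul_eq_mul_div, div_le_iff₀ hN] at this
  rw [mul_div_assoc', div_mul_eq_mul_div, le_div_iff₀ Real.pi_pos]
  linarith

/-! ### Bounds for Cauchy integrals -/

/-- The truncated logarithmic kernel `1 / |w|` on the unit disk. -/
noncomputable def truncatedInvNorm (w : ℂ) : ℝ :=
  (Metric.ball (0 : ℂ) 1).indicator (fun w => ‖w‖⁻¹) w

lemma integrable_truncatedInvNorm : Integrable truncatedInvNorm := by
  refine (integrable_indicator_iff measurableSet_ball).2 ?_
  refine (integrableOn_fun_norm_addHaar (E := ℂ) (μ := volume) (f := fun y => y⁻¹)).2 ?_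
  have : IntegrableOn (fun _ : ℝ => (1 : ℝ)) (Set.Ioo 0 1) :=
    integrableOn_const (by simp) (by simp)
  refine this.congr_fun (fun y hy => ?_) measurableSet_Ioo
  simp [mul_inv_cancel₀ hy.1.ne']

lemma truncatedInvNorm_nonneg (w : ℂ) : 0 ≤ truncatedInvNorm w :=
  Set.indicator_nonneg (fun w _ => by positivity) w

section CauchyKernel

variable {t N : ℝ}

/-- At distance at least 1 from `z` the kernel is at most 1 and AM-GM suffices; closer, the
pointwise bound `M` multiplies the integrable singularity. -/
lemma norm_eval_mul_conj_eval_div_le {f g : ℂ[X]} {z w : ℂ} {M : ℝ} (hM : 0 ≤ M)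
    (hf : ‖f.eval w‖ ^ 2 * gaussWeight t N w ≤ M)
    (hg : ‖g.eval w‖ ^ 2 * gaussWeight t N w ≤ M) :
    ‖f.eval w * conj (g.eval w) * (gaussWeight t N w : ℂ) / (z - w)‖ ≤
      (1 / 2) * (‖f.eval w‖ ^ 2 * gaussWeight t N w + ‖g.eval w‖ ^ 2 * gaussWeight t N w)
        + M * truncatedInvNorm (z - w) := by
  have hw := gaussWeight_pos t N w
  rw [norm_div, norm_mul, norm_mul, RCLike.norm_conj, Complex.norm_real, Real.norm_of_nonneg hw.le]
  set x := ‖f.eval w‖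
  set y := ‖g.eval w‖
  have hxy : x * y * gaussWeight t N w ≤
      (1 / 2) * (x ^ 2 * gaussWeight t N w + y ^ 2 * gaussWeight t N w) := by
    nlinarith [mul_nonneg (sq_nonneg (x - y)) hw.le]
  have hnn : 0 ≤ x * y * gaussWeight t N w := by positivity
  by_cases h : ‖z - w‖ < 1
  · have : truncatedInvNorm (z - w) = ‖z - w‖⁻¹ :=
      Set.indicator_of_mem (by simpa using h) _
    rw [this, div_eq_mul_inv]
    have h1 : x * y * gaussWeight t N w * ‖z - w‖⁻¹ ≤ M * ‖z - w‖⁻¹ := by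
      gcongr; linarith
    linarith
  · have h2 := mul_nonneg hM (truncatedInvNorm_nonneg (z - w))
    have := div_le_self hnn (not_lt.1 h)
    linarith

lemma integrable_eval_mul_conj_eval_div (ht0 : 0 ≤ t) (ht1 : t < 1) (hN : 0 < N) (f g : ℂ[X])
    (z : ℂ) :
    Integrable (fun w : ℂ => f.eval w * conj (g.eval w) * (gaussWeight t N w : ℂ) / (z - w)) ∧
    ((∫ w : ℂ, ‖f.eval w‖ ^ 2 * gaussWeight t N w) = 1 →
      (∫ w : ℂ, ‖g.eval w‖ ^ 2 * gaussWeight t N w) = 1 →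
      ‖∫ w : ℂ, f.eval w * conj (g.eval w) * (gaussWeight t N w : ℂ) / (z - w)‖ ≤
        1 + N * (Real.exp 1 / Real.pi) * ∫ w, truncatedInvNorm w) := by
  have hIf := integrable_norm_eval_sq ht0 ht1 hN f
  have hIg := integrable_norm_eval_sq ht0 ht1 hN g
  have hF0 : ∀ (f : ℂ[X]) w, 0 ≤ ‖f.eval w‖ ^ 2 * gaussWeight t N w :=
    fun f w => mul_nonneg (by positivity) (gaussWeight_pos t N w).le
  set a := ∫ w : ℂ, ‖f.eval w‖ ^ 2 * gaussWeight t N w with ha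
  set b := ∫ w : ℂ, ‖g.eval w‖ ^ 2 * gaussWeight t N w with hb
  have ha0 : 0 ≤ a := integral_nonneg (hF0 f)
  have hb0 : 0 ≤ b := integral_nonneg (hF0 g)
  set M := N * (Real.exp 1 / Real.pi) * max a b with hM
  have hc : 0 ≤ N * (Real.exp 1 / Real.pi) := by have := Real.pi_pos; positivity
  have hM0 : 0 ≤ M := mul_nonneg hc (ha0.trans (le_max_left _ _))
  have hle : ∀ w, ‖f.eval w * conj (g.eval w) * (gaussWeight t N w : ℂ) / (z - w)‖ ≤
      (1 / 2) * (‖f.eval w‖ ^ 2 * gaussWeight t N w + ‖g.eval w‖ ^ 2 * gaussWeight t N w)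
        + M * truncatedInvNorm (z - w) := fun w =>
    norm_eval_mul_conj_eval_div_le hM0
      ((norm_eval_sq_mul_gaussWeight_le ht0 ht1 hN f w).trans
        (mul_le_mul_of_nonneg_left (le_max_left _ _) hc))
      ((norm_eval_sq_mul_gaussWeight_le ht0 ht1 hN g w).trans
        (mul_le_mul_of_nonneg_left (le_max_right _ _) hc))
  have hItr : Integrable fun w => truncatedInvNorm (z - w) :=
    integrable_truncatedInvNorm.comp_sub_left z
  have hIfg := (hIf.add hIg).const_mul (1 / 2)
  have hbound := hIfg.add (hItr.const_mul M)
  have hwc := continuous_gaussWeight t N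
  refine ⟨hbound.mono' ?_ (Filter.Eventually.of_forall hle), fun h1 h2 => ?_⟩
  · refine Measurable.aestronglyMeasurable (Measurable.div ?_ (by fun_prop))
    exact Continuous.measurable (by fun_prop)
  · refine (norm_integral_le_of_norm_le hbound (Filter.Eventually.of_forall hle)).trans ?_
    rw [integral_add' hIfg (hItr.const_mul M), integral_const_mul, integral_const_mul,
      integral_add' hIf hIg, integral_sub_left_eq_self truncatedInvNorm volume z]
    rw [← ha, ← hb, hM, h1, h2]
    norm_num

end CauchyKernel

/-! ### Using orthogonality in the Cauchy transform -/

section Orthonormal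

variable {t N : ℝ} {p : ℕ → ℂ[X]}

lemma cauchyIntegrand_eq (t N : ℝ) (q : ℂ[X]) (z w : ℂ) :
    cauchyIntegrand (potential (fun z => (t : ℂ) * z ^ 2 / 2)) N q z w =
      q.eval w * conj (q.eval w) * (gaussWeight t N w : ℂ) / (z - w) := by
  rw [cauchyIntegrand, Complex.mul_conj', Complex.ofReal_mul, Complex.ofReal_pow]
  rfl

lemma IsOrthonormalPolynomials.integral_norm_eval_sq
    (hp : IsOrthonormalPolynomials (potential (fun z => (t : ℂ) * z ^ 2 / 2)) N p) (n : ℕ) :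
    ∫ w : ℂ, ‖(p n).eval w‖ ^ 2 * gaussWeight t N w = 1 := by
  have h := hp.polyInner_eq n n
  rw [polyInner_self, if_pos rfl] at h
  exact_mod_cast h

/-- Orthogonality lets one trade the factor `p n` of `|p n|²` for a polynomial `r` of degree
at most `n`. -/
lemma IsOrthonormalPolynomials.integral_cauchyIntegrand_mul (ht0 : 0 ≤ t) (ht1 : t < 1)
    (hN : 0 < N)
    (hp : IsOrthonormalPolynomials (potential (fun z => (t : ℂ) * z ^ 2 / 2)) N p) {n : ℕ}
    {r : ℂ[X]} (hr : r.degree ≤ n) (z : ℂ) :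
    (∫ w : ℂ, cauchyIntegrand (potential (fun z => (t : ℂ) * z ^ 2 / 2)) N (p n) z w) *
        r.eval z =
      (p n).eval z *
        ∫ w : ℂ, r.eval w * conj ((p n).eval w) * (gaussWeight t N w : ℂ) / (z - w) := by
  set G : ℂ[X] := p n * C (r.eval z) - C ((p n).eval z) * r with hG
  have hGdeg : G.degree ≤ n := by
    refine (degree_sub_le _ _).trans (max_le ?_ ?_)
    · refine (degree_mul_le _ _).trans ?_
      rw [hp.degree_eq]
      exact (add_le_add_right degree_C_le _).trans (by simp)
    · refine (degree_mul_le _ _).trans ?_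
      exact (add_le_add degree_C_le hr).trans (by simp)
  obtain ⟨s, hs⟩ : X - C z ∣ G := dvd_iff_isRoot.2 (by simp [hG, IsRoot, mul_comm])
  have hsdeg : s.degree < n := by
    by_cases h0 : s = 0
    · rw [h0, degree_zero]; exact WithBot.bot_lt_coe _
    rw [hs, degree_mul, degree_X_sub_C, degree_eq_natDegree h0] at hGdeg
    rw [degree_eq_natDegree h0]
    have : 1 + s.natDegree ≤ n := by exact_mod_cast hGdeg
    exact_mod_cast (by omega : s.natDegree < n)
  have hI1 := (integrable_eval_mul_conj_eval_div ht0 ht1 hN (p n) (p n) z).1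
  have hI2 := (integrable_eval_mul_conj_eval_div ht0 ht1 hN r (p n) z).1
  have horth := hp.polyInner_of_degree_lt ht0 ht1 hN hsdeg
  simp only [cauchyIntegrand_eq]
  rw [← sub_eq_zero, ← integral_mul_const, ← integral_const_mul,
    ← integral_sub (hI1.mul_const _) (hI2.const_mul _), ← neg_eq_zero, ← integral_neg, ← horth,
    polyInner]
  refine integral_congr_ae ?_
  -- At `w = z` division by zero breaks the pointwise identity, so this null set is removed.
  filter_upwards [measure_eq_zero_iff_ae_notMem.1 (measure_singleton z)] with w hw
  have hne : z - w ≠ 0 := sub_ne_zero.2 fun h => hw h.symm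
  have hsw : (p n).eval w * r.eval z - (p n).eval z * r.eval w = (w - z) * s.eval w := by
    have := congrArg (eval w) hs
    simpa [hG] using this
  field_simp
  linear_combination (-(gaussWeight t N w : ℂ) * conj ((p n).eval w)) * hsw

lemma IsOrthonormalPolynomials.norm_integral_cauchyIntegrand_mul_le (ht0 : 0 ≤ t) (ht1 : t < 1)
    (hN : 0 < N)
    (hp : IsOrthonormalPolynomials (potential (fun z => (t : ℂ) * z ^ 2 / 2)) N p) {k n : ℕ}
    (hk : k ≤ n) (z : ℂ) :
    ‖∫ w : ℂ, cauchyIntegrand (potential (fun z => (t : ℂ) * z ^ 2 / 2)) N (p n) z w‖ *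
        ‖(p k).eval z‖ ≤
      ‖(p n).eval z‖ * (1 + N * (Real.exp 1 / Real.pi) * ∫ w, truncatedInvNorm w) := by
  rw [← norm_mul, hp.integral_cauchyIntegrand_mul ht0 ht1 hN
    (by rw [hp.degree_eq]; exact_mod_cast hk), norm_mul]
  gcongr
  exact (integrable_eval_mul_conj_eval_div ht0 ht1 hN (p k) (p n) z).2
    (hp.integral_norm_eval_sq k) (hp.integral_norm_eval_sq n)

end Orthonormal

/-! ### Decay of the normalized Hermite values -/

/-- The value at `z` of the normalized Hermite polynomial of degree `k`. -/
noncomputable def hermiteValue (t N : ℝ) (z : ℂ) (k : ℕ) : ℂ :=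
  (hermiteMonic (t / (N * (1 - t ^ 2))) k).eval z / (√(hermiteNormSq t N k) : ℂ)

lemma hermiteNormSq_succ (t N : ℝ) (k : ℕ) :
    hermiteNormSq t N (k + 1) = (k + 1) * (1 / (N * (1 - t ^ 2))) * hermiteNormSq t N k := by
  simp only [hermiteNormSq, Nat.factorial_succ]
  push_cast
  ring

lemma hermiteValue_succ_succ {t N : ℝ} (ht0 : 0 ≤ t) (ht1 : t < 1) (hN : 0 < N) (z : ℂ) (k : ℕ) :
    hermiteValue t N z (k + 2) =
      z / (√(1 / (N * (1 - t ^ 2))) * √(k + 2) : ℝ) * hermiteValue t N z (k + 1)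
        - t * (√(k + 1) / √(k + 2) : ℝ) * hermiteValue t N z k := by
  set σ : ℝ := 1 / (N * (1 - t ^ 2)) with hσ
  have hσ0 : 0 < σ := one_div_pos.2 (mul_pos hN (by nlinarith))
  have hτ : (t / (N * (1 - t ^ 2)) : ℂ) = t * σ := by rw [hσ]; push_cast; ring
  have hk1 : (0 : ℝ) < (k : ℝ) + 1 := by positivity
  have hk2 : (0 : ℝ) < (k : ℝ) + 2 := by positivity
  have hsq : ∀ j : ℕ, √(hermiteNormSq t N (j + 1)) =
      √((j : ℝ) + 1) * √σ * √(hermiteNormSq t N j) := fun j => by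
    rw [hermiteNormSq_succ, Real.sqrt_mul (by positivity), Real.sqrt_mul (by positivity)]
  have h2 : √(hermiteNormSq t N (k + 2)) =
      √((k : ℝ) + 2) * √σ * √(hermiteNormSq t N (k + 1)) := by
    rw [hsq (k + 1)]; push_cast; ring_nf
  simp only [hermiteValue]
  rw [hermiteMonic_succ_succ, h2, hsq k, hτ]
  simp only [eval_sub, eval_mul, eval_X, eval_C]
  have hc : ∀ x : ℝ, 0 < x → (√x : ℂ) ≠ 0 := fun x hx => by
    exact_mod_cast (Real.sqrt_pos.2 hx).ne'
  have e1 := hc _ hσ0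
  have e2 := hc _ hk1
  have e3 := hc _ hk2
  have e4 := hc _ (hermiteNormSq_pos ht0 ht1 hN k)
  have f1 : (σ : ℂ) = (√σ : ℂ) ^ 2 := by exact_mod_cast (Real.sq_sqrt hσ0.le).symm
  have f2 : ((k : ℂ) + 1) = (√((k : ℝ) + 1) : ℂ) ^ 2 := by
    exact_mod_cast (Real.sq_sqrt hk1.le).symm
  rw [f2]
  set a := (hermiteMonic (t * σ) (k + 1)).eval z
  set b := (hermiteMonic (t * σ) k).eval z
  rw [f1]
  push_cast
  field_simp

lemma abs_sqrt_sub_one_le {x : ℝ} (hx : 0 ≤ x) : |√x - 1| ≤ |x - 1| := by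
  have h : x - 1 = (√x - 1) * (√x + 1) := by
    linear_combination -(Real.mul_self_sqrt hx)
  rw [h, abs_mul]
  have h1 : 1 ≤ |√x + 1| := by
    rw [abs_of_nonneg (by positivity)]
    linarith [Real.sqrt_nonneg x]
  exact le_mul_of_one_le_right (abs_nonneg _) h1

/-- Division by `B = √(T / (1 - t²))` carries the droplet to the Joukowski ellipse of `l + t / l`.
The roots are those of `l² - (z / B) l + t`. -/
lemma exists_roots_norm_lt_one {t T : ℝ} (ht0 : 0 ≤ t) (ht1 : t < 1) (hT : 0 < T) {z : ℂ}
    (hz : z ∈ interior (droplet t T)) :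
    ∃ l₁ l₂ : ℂ, ‖l₁‖ < 1 ∧ ‖l₂‖ < 1 ∧ l₁ + l₂ = z / (√(T / (1 - t ^ 2)) : ℝ) ∧ l₁ * l₂ = t := by
  have hD : 0 < 1 - t ^ 2 := by nlinarith
  set B := √(T / (1 - t ^ 2)) with hB
  have hB2 : B ^ 2 = T / (1 - t ^ 2) := Real.sq_sqrt (by positivity)
  have hB0 : 0 < B := Real.sqrt_pos.2 (by positivity)
  set a : ℂ := z / (B : ℝ) with ha
  have hell : (1 - t) ^ 2 * a.re ^ 2 + (1 + t) ^ 2 * a.im ^ 2 < (1 - t ^ 2) ^ 2 := by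
    have h := re_sq_add_im_sq_lt_of_mem_interior_droplet hT hz
    have hre : a.re = z.re / B := Complex.div_ofReal_re _ _
    have him : a.im = z.im / B := Complex.div_ofReal_im _ _
    have h1 : 0 < 1 - t := by linarith
    have h2 : 0 < 1 + t := by linarith
    have key : (1 - t) ^ 2 * a.re ^ 2 + (1 + t) ^ 2 * a.im ^ 2 =
        ((1 - t) / (1 + t) * z.re ^ 2 + (1 + t) / (1 - t) * z.im ^ 2) *
          ((1 - t ^ 2) ^ 2 / T) := by
      rw [hre, him, div_pow, div_pow, hB2]
      have : 1 - t ^ 2 = (1 - t) * (1 + t) := by ring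
      rw [this]
      field_simp
    rw [key]
    calc _ < T * ((1 - t ^ 2) ^ 2 / T) := by gcongr
      _ = _ := by field_simp
  obtain ⟨s, hs⟩ := IsAlgClosed.exists_pow_nat_eq (a ^ 2 - 4 * t) (n := 2) (by norm_num)
  refine ⟨(a + s) / 2, (a - s) / 2, norm_lt_one_of_joukowski ht0 ht1 hell ?_,
    norm_lt_one_of_joukowski ht0 ht1 hell ?_, by ring, ?_⟩
  · linear_combination hs / 4
  · linear_combination hs / 4
  · linear_combination -hs / 4

/-- Inside the droplet the normalized Hermite polynomials decay exponentially over the last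
`δ n` degrees. -/
lemma exists_hermiteValue_decay {t T : ℝ} (ht0 : 0 ≤ t) (ht1 : t < 1) (hT : 0 < T) {z : ℂ}
    (hz : z ∈ interior (droplet t T)) :
    ∃ δ > (0 : ℝ), ∃ q : ℝ, 0 < q ∧ q < 1 ∧ ∃ A > (0 : ℝ), ∀ (N : ℝ) (n : ℕ), 0 < N →
      (n : ℝ) = N * T → 1 ≤ δ * n → ∃ m j : ℕ, m + 1 ≤ n ∧ δ * n - 1 ≤ j ∧
        ‖hermiteValue t N z n‖ ≤
          A * q ^ j * (‖hermiteValue t N z m‖ + ‖hermiteValue t N z (m + 1)‖) := by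
  obtain ⟨l₁, l₂, h₁, h₂, hadd, hmul⟩ := exists_roots_norm_lt_one ht0 ht1 hT hz
  obtain ⟨η, hη, q, hq0, hq1, A, hA, hdecay⟩ := exists_decay_of_recurrence h₁ h₂
  have hD : 0 < 1 - t ^ 2 := by nlinarith
  set B := √(T / (1 - t ^ 2)) with hB
  have hB0 : 0 < B := Real.sqrt_pos.2 (by positivity)
  set a : ℂ := z / (B : ℝ) with ha
  -- For `n - δ n ≤ k < n` one has `k + 2 ≥ n / 2`, so `n / (k + 2)` and `(k + 1) / (k + 2)` are
  -- within `2δ` of 1. The coefficients then differ from `a` and `t` by at most `2δ‖a‖` and `2δt`,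
  -- both at most `η`.
  set δ := min (1 / 2) (η / (2 * (‖a‖ + 1))) with hδ
  have hδ0 : 0 < δ := lt_min (by norm_num) (by positivity)
  have hδ1 : δ ≤ 1 / 2 := min_le_left _ _
  have hδη : 2 * δ * (‖a‖ + 1) ≤ η := by
    have : δ ≤ η / (2 * (‖a‖ + 1)) := min_le_right _ _
    rw [le_div_iff₀ (by positivity)] at this
    linarith
  refine ⟨δ, hδ0, q, hq0, hq1, A, hA, fun N n hN hn hδn => ?_⟩
  have hn0 : (0 : ℝ) < n := by rw [hn]; positivity
  set j := ⌊δ * n⌋₊ with hj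
  have hj_le : (j : ℝ) ≤ δ * n := Nat.floor_le (by positivity)
  have hj1 : 1 ≤ j := Nat.one_le_floor_iff _ |>.2 hδn
  have hj_lt : δ * n < j + 1 := Nat.lt_floor_add_one _
  have hjn : j ≤ n := by
    have : (j : ℝ) ≤ n := by nlinarith
    exact_mod_cast this
  refine ⟨n - j, j, by omega, by linarith, ?_⟩
  have hmj : n - j + j = n := by omega
  have hmr : ((n - j : ℕ) : ℝ) = n - j := by rw [Nat.cast_sub hjn]
  have h := hdecay (hermiteValue t N z) (n - j) j ?_
  · rwa [hmj] at h
  intro k hk1 hk2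
  rw [hmj] at hk2
  have hk1' : (n : ℝ) - j ≤ k := by rw [← hmr]; exact_mod_cast hk1
  have hk2' : (k : ℝ) + 1 ≤ n := by exact_mod_cast hk2
  have hkn : (n : ℝ) / 2 ≤ k + 2 := by nlinarith
  have hkpos : (0 : ℝ) < (k : ℝ) + 2 := by positivity
  set y := hermiteValue t N z
  set σ : ℝ := 1 / (N * (1 - t ^ 2)) with hσ
  have hσ0 : 0 < σ := by positivity
  -- Here `n = N T` enters: the rescaled recurrence coefficient becomes `a √(n / (k + 2))`.
  have hBσ : B = √σ * √n := by
    rw [← Real.sqrt_mul hσ0.le, hB, hσ, hn]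
    congr 1
    field_simp
  have hcoef : z / (√σ * √(k + 2) : ℝ) = a * (√(n / (k + 2)) : ℝ) := by
    rw [ha, hBσ, Real.sqrt_div hn0.le]
    have e1 : (√σ : ℂ) ≠ 0 := by exact_mod_cast (Real.sqrt_pos.2 hσ0).ne'
    have e2 : (√(n : ℝ) : ℂ) ≠ 0 := by exact_mod_cast (Real.sqrt_pos.2 hn0).ne'
    have e3 : (√((k : ℝ) + 2) : ℂ) ≠ 0 := by exact_mod_cast (Real.sqrt_pos.2 hkpos).ne'
    push_cast
    field_simp
  have hcoef2 : √((k : ℝ) + 1) / √(k + 2) = √((k + 1) / (k + 2)) := by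
    rw [Real.sqrt_div (by positivity)]
  have hx : |√((n : ℝ) / (k + 2)) - 1| ≤ 2 * δ := by
    refine (abs_sqrt_sub_one_le (by positivity)).trans ?_
    rw [div_sub_one hkpos.ne', abs_div, abs_of_pos hkpos, div_le_iff₀ hkpos, abs_le]
    have := mul_le_mul_of_nonneg_left hkn hδ0.le
    constructor <;> linarith
  have hx2 : |√(((k : ℝ) + 1) / (k + 2)) - 1| ≤ 2 * δ := by
    refine (abs_sqrt_sub_one_le (by positivity)).trans ?_
    rw [div_sub_one hkpos.ne', abs_div, abs_of_pos hkpos, div_le_iff₀ hkpos, abs_le]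
    have := mul_le_mul_of_nonneg_left hkn hδ0.le
    constructor <;> linarith
  have hrec := hermiteValue_succ_succ ht0 ht1 hN z k
  rw [hcoef, hcoef2] at hrec
  change y (k + 2) = _ at hrec
  rw [hadd, hmul, hrec]
  have hrw : a * (√((n : ℝ) / (k + 2)) : ℝ) * y (k + 1) -
        t * (√(((k : ℝ) + 1) / (k + 2)) : ℝ) * y k - (a * y (k + 1) - t * y k) =
      a * ((√((n : ℝ) / (k + 2)) - 1 : ℝ) : ℂ) * y (k + 1) -
        t * ((√(((k : ℝ) + 1) / (k + 2)) - 1 : ℝ) : ℂ) * y k := by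
    push_cast; ring
  rw [hrw]
  refine (norm_sub_le _ _).trans ?_
  simp only [norm_mul, Complex.norm_real, Real.norm_eq_abs]
  rw [abs_of_nonneg ht0]
  have b1 : ‖a‖ * |√((n : ℝ) / (k + 2)) - 1| ≤ η := by
    calc _ ≤ ‖a‖ * (2 * δ) := by gcongr
      _ ≤ η := by linarith
  have b2 : t * |√(((k : ℝ) + 1) / (k + 2)) - 1| ≤ η := by
    calc _ ≤ 1 * (2 * δ) := by gcongr
      _ ≤ η := by nlinarith [mul_nonneg hδ0.le (norm_nonneg a)]
  have := mul_le_mul_of_nonneg_right b1 (norm_nonneg (y (k + 1)))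
  have := mul_le_mul_of_nonneg_right b2 (norm_nonneg (y k))
  linarith

/-! ### Conclusion -/

lemma IsOrthonormalPolynomials.norm_eval {t N : ℝ} {p : ℕ → ℂ[X]} (ht0 : 0 ≤ t) (ht1 : t < 1)
    (hN : 0 < N)
    (hp : IsOrthonormalPolynomials (potential (fun z => (t : ℂ) * z ^ 2 / 2)) N p) (k : ℕ)
    (z : ℂ) : ‖(p k).eval z‖ = ‖hermiteValue t N z k‖ := by
  obtain ⟨c, hc, hpk⟩ := hp.exists_eq_C_mul ht0 ht1 hN k
  have hpos := hermiteNormSq_pos ht0 ht1 hN k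
  have hsq : ‖c‖ * √(hermiteNormSq t N k) = 1 := by
    rw [← Real.sqrt_sq (norm_nonneg c), ← Real.sqrt_mul (by positivity), hc, Real.sqrt_one]
  have hne := (Real.sqrt_pos.2 hpos).ne'
  rw [hpk, hermiteValue, eval_mul, eval_C, norm_mul, norm_div, Complex.norm_real,
    Real.norm_of_nonneg (Real.sqrt_nonneg _), eq_div_iff hne]
  linear_combination ‖eval z (hermiteMonic (t / (N * (1 - t ^ 2))) k)‖ * hsq

theorem mainTheorem6 (t T : ℝ) (ht0 : 0 ≤ t) (ht1 : t < 1) (hT : 0 < T)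
    (V : ℂ → ℝ) (hV : V = potential (fun z => (t : ℂ) * z ^ 2 / 2)) :
    (∀ N : ℝ, 0 < N → ∃ p : ℕ → ℂ[X], IsOrthonormalPolynomials V N p) ∧
    ∀ z ∈ interior (droplet t T), ∃ ε > (0 : ℝ), ∃ C > (0 : ℝ), ∃ N₀ > (0 : ℝ),
      ∀ (N : ℝ) (n : ℕ), N₀ < N → (n : ℝ) = N * T →
        ∀ p : ℕ → ℂ[X], IsOrthonormalPolynomials V N p →
          Integrable (fun w : ℂ => cauchyIntegrand V N (p n) z w) ∧
          ‖∫ w : ℂ, cauchyIntegrand V N (p n) z w‖ ≤ C * Real.exp (-ε * N) := by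
  subst hV
  refine ⟨fun N hN => exists_isOrthonormalPolynomials ht0 ht1 hN, fun z hz => ?_⟩
  obtain ⟨δ, hδ, q, hq0, hq1, A, hA, hdecay⟩ := exists_hermiteValue_decay ht0 ht1 hT hz
  have hlog : Real.log q < 0 := Real.log_neg hq0 hq1
  -- Thus `q^{δ n} = e^{-2εN}`; half of this rate pays for the linear factor `1 + N c`. The `q⁻¹` in
  -- the constant comes from `j ≥ δ n - 1`, and `N₀` ensures `δ n ≥ 1`.
  set ε := -(δ * T * Real.log q) / 2 with hε
  have hε0 : 0 < ε := by
    have := mul_neg_of_pos_of_neg (mul_pos hδ hT) hlog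
    rw [hε]; linarith
  set c := Real.exp 1 / Real.pi * ∫ w, truncatedInvNorm w with hc
  have hc0 : 0 ≤ c := mul_nonneg (by have := Real.pi_pos; positivity)
    (integral_nonneg truncatedInvNorm_nonneg)
  refine ⟨ε, hε0, 2 * A * q⁻¹ * (1 + c / ε), by positivity, 1 / (δ * T), by positivity, ?_⟩
  intro N n hN hn p hp
  have hN0 : 0 < N := lt_trans (by positivity) hN
  refine ⟨?_, ?_⟩
  · simp only [cauchyIntegrand_eq]
    exact (integrable_eval_mul_conj_eval_div ht0 ht1 hN0 (p n) (p n) z).1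
  have hδn : 1 ≤ δ * n := by
    rw [div_lt_iff₀ (by positivity)] at hN
    rw [hn]; linarith
  obtain ⟨m, j, hmn, hj, hle⟩ := hdecay N n hN0 hn hδn
  have hbound : ∀ k ≤ n,
      ‖∫ w : ℂ, cauchyIntegrand (potential (fun z => (t : ℂ) * z ^ 2 / 2)) N (p n) z w‖ *
        ‖hermiteValue t N z k‖ ≤ ‖hermiteValue t N z n‖ * (1 + N * c) := fun k hk => by
    have := hp.norm_integral_cauchyIntegrand_mul_le ht0 ht1 hN0 hk z
    rwa [hp.norm_eval ht0 ht1 hN0, hp.norm_eval ht0 ht1 hN0, mul_assoc N, ← hc] at this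
  set I := ‖∫ w : ℂ, cauchyIntegrand (potential (fun z => (t : ℂ) * z ^ 2 / 2)) N (p n) z w‖
  set S := ‖hermiteValue t N z m‖ + ‖hermiteValue t N z (m + 1)‖ with hS
  have hS0 : 0 ≤ S := by positivity
  have hIS : I * S ≤ 2 * A * q ^ j * (1 + N * c) * S := by
    have h1 := hbound m (by omega)
    have h2 := hbound (m + 1) hmn
    have h3 := mul_le_mul_of_nonneg_right hle (by positivity : 0 ≤ 1 + N * c)
    rw [hS] at h3 ⊢
    linarith
  have hI : I ≤ 2 * A * q ^ j * (1 + N * c) := by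
    -- If `S = 0` it cannot be cancelled, but then `p_n(z) = 0`, and comparison with the nonzero
    -- constant `p_0` forces `I = 0`.
    rcases hS0.eq_or_lt with h | h
    · have hn0 : ‖hermiteValue t N z n‖ = 0 :=
        le_antisymm (by simpa [← h] using hle) (norm_nonneg _)
      have h0 := hbound 0 (Nat.zero_le n)
      have hv : 0 < ‖hermiteValue t N z 0‖ := by
        have := Real.sqrt_pos.2 (hermiteNormSq_pos ht0 ht1 hN0 0)
        simp [hermiteValue, hermiteMonic, abs_of_pos this, this]
      rw [hn0, zero_mul] at h0
      have : I ≤ 0 := by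
        by_contra! hpos
        exact absurd (mul_pos hpos hv) (not_lt.2 h0)
      exact this.trans (by positivity)
    · exact le_of_mul_le_mul_right hIS h
  have hqj : q ^ j ≤ q⁻¹ * Real.exp (-(2 * ε) * N) := by
    have h1 : q ^ j = Real.exp (Real.log q * j) := by
      rw [Real.exp_mul, Real.exp_log hq0, Real.rpow_natCast]
    have h2 : q⁻¹ = Real.exp (-Real.log q) := by rw [Real.exp_neg, Real.exp_log hq0]
    rw [h1, h2, ← Real.exp_add]
    apply Real.exp_le_exp.2
    have := mul_le_mul_of_nonpos_left hj hlog.le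
    have e : -Real.log q + -(2 * ε) * N = Real.log q * (δ * n - 1) := by
      rw [hε, hn]; ring
    linarith
  have hpoly : 1 + N * c ≤ (1 + c / ε) * Real.exp (ε * N) := by
    have h1 : ε * N + 1 ≤ Real.exp (ε * N) := Real.add_one_le_exp _
    have h2 : N * c = c / ε * (ε * N) := by field_simp
    have h3 : c / ε * (ε * N) ≤ c / ε * Real.exp (ε * N) := by gcongr; linarith
    have h4 : 0 < ε * N := by positivity
    linarith
  calc I ≤ 2 * A * q ^ j * (1 + N * c) := hI
    _ ≤ 2 * A * (q⁻¹ * Real.exp (-(2 * ε) * N)) * ((1 + c / ε) * Real.exp (ε * N)) := by gcongr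
    _ = 2 * A * q⁻¹ * (1 + c / ε) * (Real.exp (-(2 * ε) * N) * Real.exp (ε * N)) := by ring
    _ = _ := by rw [← Real.exp_add]; ring_nf
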